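/- Let $a:[0,\infty)\to[0,\infty)$ be differentiable and non-increasing with $\lim_{t\to\infty}a(t)=0$, and assume that there is $c>0$ such that $a(t)\ge \frac{c}{t+1}$ for all $t\ge 0$. Let $G:\mathbb{R}\to\mathbb{R}$ be of class $C^1$ and coercive (i.e. $G(\xi)\to\infty$ as $|\xi|\to\infty$), with $G'$ Lipschitz continuous on bounded sets. Assume that (a) $G$ has finitely many critical points; (b) $G$ takes different values at different critical points; (c) near each critical point $p$, $G$ is either strongly convex or strongly concave, where $G$ is called strongly convex near $p$ if there are $\varepsilon,\delta>0$ with $G(y)\ge G(x)+(y-x)G'(x)+\delta(y-x)^2$ for all $x,y\in(p-\varepsilon,p+\varepsilon)$, and strongly concave near $p$ if $-G$ is strongly convex near $p$. Let $x:[0,\infty)\to\mathbb{R}$ be any $C^2$ solution of $$\ddot x(t)+a(t)\,\dot x(t)+G'(x(t))=0,\qquad t\ge 0.$$ Then $\lim_{t\to\infty}x(t)$ exists. Moreover, if $x$ is not constant and $\mathcal{T}$ denotes the set of times $t>0$ at which $\dot x$ changes sign, then the limit is a local maximum point of $G$ if and only if $\mathcal{T}$ is finite, and it is a local minimum point of $G$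 if and only if $\mathcal{T}$ is infinite. -/

import Mathlib

open Set Filter Topology

namespace DampedGradient

/-- `G` is strongly convex in a neighbourhood of `p`:
`G y ≥ G x + (y - x) G'(x) + δ (y - x)²` for all `x, y ∈ ]p - ε, p + ε[`, for some `ε, δ > 0`. -/
def StronglyConvexNear (G : ℝ → ℝ) (p : ℝ) : Prop :=
  ∃ ε > 0, ∃ δ > 0, ∀ x ∈ Ioo (p - ε) (p + ε), ∀ y ∈ Ioo (p - ε) (p + ε),
    G x + (y - x) * deriv G x + δ * (y - x) ^ 2 ≤ G y

/-- `G` is strongly concave in a neighbourhood of `p` if `-G` is strongly convex there. -/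
def StronglyConcaveNear (G : ℝ → ℝ) (p : ℝ) : Prop :=
  StronglyConvexNear (fun x => - G x) p

/-- The velocity of `x : [0, ∞) → ℝ`; one-sided at `t = 0`. -/
noncomputable def velocity (x : ℝ → ℝ) : ℝ → ℝ :=
  derivWithin x (Ici 0)

/-- `x` is a `C²` solution on `[0, ∞)` of `x'' + a(t) x' + G'(x) = 0`.
Only the values of `a` and `x` on `[0, ∞)` matter. -/
structure IsSolution (a G x : ℝ → ℝ) : Prop where
  contDiffOn : ContDiffOn ℝ 2 x (Ici 0)
  equation : ∀ t, 0 ≤ t →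
    derivWithin (velocity x) (Ici 0) t + a t * velocity x t + deriv G (x t) = 0

/-- The times `t > 0` at which `v` changes sign: `v` has one strict sign on an interval
immediately to the left of `t` and the opposite strict sign on one immediately to the right. -/
def signChanges (v : ℝ → ℝ) : Set ℝ :=
  {t | 0 < t ∧ ∃ ε > 0, ε ≤ t ∧
    ∀ r ∈ Ioo (t - ε) t, ∀ s ∈ Ioo t (t + ε), v r * v s < 0}

end DampedGradient

/-! The energy `v^2 / 2 + G(x)` decreases at rate `a v^2`. Coercivity keeps the motion bounded, so
the energy has a limit `e`. Since `a t ≥ c / (t + 1)`, a unit of time begun at a late time `t` away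
from equilibria on the level `e` costs a multiple of `1 / t` (`exists_dissipation_on`). Such losses
cannot recur forever with logarithmic gaps, because `∑ 1 / (n log n)` diverges
(`not_logarithmically_dissipating`). Hence `e = G p` for a critical point `p`, unique since critical
values are distinct, and the trajectory keeps returning near `p`.

If `p` is a minimum, the low energy traps the motion. If `p` is a maximum, suppose the motion leaves
a neighbourhood again and again. An exit at time `r` costs a multiple of `1 / r`, so before `r` the
energy exceeds `G p` by at least that much. Crossing a quadratic hilltop with excess `σ` takes time
`O(log (1 / σ))` (`transit_time_le`), here `O(log r)`. The gaps between exits are therefore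
logarithmic, a contradiction.

By uniqueness for the ODE, a nonconstant motion never meets an equilibrium, so zeros of `v` are
simple. Near a minimum a Riccati argument forces endless oscillation; near a maximum the energy
leaves no room for `v = 0`. -/

namespace DampedGradient

/-! ### Energy, a priori bounds and uniqueness at equilibria -/

/-- `x` with velocity `v` solves `x'' + a x' + G'(x) = 0` on `[0, ∞)`, where the damping `a` is
nonnegative and nonincreasing. -/
structure Trajectory (a G x v : ℝ → ℝ) : Prop where
  nonneg : ∀ t, 0 ≤ t → 0 ≤ a t
  anti : AntitoneOn a (Ici 0)
  contDiff : ContDiff ℝ 1 G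
  position : ∀ t, 0 ≤ t → HasDerivWithinAt x (v t) (Ici 0) t
  momentum : ∀ t, 0 ≤ t → HasDerivWithinAt v (-(a t * v t) - deriv G (x t)) (Ici 0) t

/-- The mechanical energy. -/
noncomputable def energy (G x v : ℝ → ℝ) (t : ℝ) : ℝ := v t ^ 2 / 2 + G (x t)

namespace Trajectory

variable {a G x v : ℝ → ℝ}

lemma hasDerivAt_position (h : Trajectory a G x v) {t : ℝ} (ht : 0 < t) :
    HasDerivAt x (v t) t :=
  (h.position t ht.le).hasDerivAt (Ici_mem_nhds ht)

lemma hasDerivAt_momentum (h : Trajectory a G x v) {t : ℝ} (ht : 0 < t) :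
    HasDerivAt v (-(a t * v t) - deriv G (x t)) t :=
  (h.momentum t ht.le).hasDerivAt (Ici_mem_nhds ht)

lemma continuousOn_position (h : Trajectory a G x v) : ContinuousOn x (Ici 0) :=
  fun t ht => (h.position t ht).continuousWithinAt

lemma continuousOn_velocity (h : Trajectory a G x v) : ContinuousOn v (Ici 0) :=
  fun t ht => (h.momentum t ht).continuousWithinAt

lemma hasDerivAt_potential (h : Trajectory a G x v) (y : ℝ) : HasDerivAt G (deriv G y) y :=
  ((h.contDiff.differentiable (by norm_num)) y).hasDerivAt

lemma continuous_deriv (h : Trajectory a G x v) : Continuous (deriv G) :=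
  h.contDiff.continuous_deriv (le_refl _)

lemma damping_le (h : Trajectory a G x v) {t : ℝ} (ht : 0 ≤ t) : a t ≤ a 0 :=
  h.anti (mem_Ici.2 le_rfl) ht ht

lemma continuousOn_energy (h : Trajectory a G x v) : ContinuousOn (energy G x v) (Ici 0) :=
  ((h.continuousOn_velocity.pow 2).div_const 2).add
    (h.contDiff.continuous.comp_continuousOn h.continuousOn_position)

lemma hasDerivAt_energy (h : Trajectory a G x v) {t : ℝ} (ht : 0 < t) :
    HasDerivAt (energy G x v) (-(a t * v t ^ 2)) t := by
  have h1 := ((h.hasDerivAt_momentum ht).pow 2).div_const 2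
  have h2 := (h.hasDerivAt_potential (x t)).comp t (h.hasDerivAt_position ht)
  refine (h1.add h2).congr_deriv ?_
  push_cast
  ring

lemma antitoneOn_energy (h : Trajectory a G x v) : AntitoneOn (energy G x v) (Ici 0) := by
  refine antitoneOn_of_deriv_nonpos (convex_Ici 0) h.continuousOn_energy ?_ ?_
  · intro t ht
    rw [interior_Ici] at ht
    exact (h.hasDerivAt_energy ht).differentiableAt.differentiableWithinAt
  · intro t ht
    rw [interior_Ici] at ht
    rw [(h.hasDerivAt_energy ht).deriv]
    have := mul_nonneg (h.nonneg t (le_of_lt ht)) (sq_nonneg (v t))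
    linarith

lemma potential_le_energy (t : ℝ) : G (x t) ≤ energy G x v t := by
  unfold energy
  nlinarith [sq_nonneg (v t)]

lemma exists_position_bound (h : Trajectory a G x v)
    (hG : Tendsto G (Bornology.cobounded ℝ) atTop) : ∃ R > 0, ∀ t, 0 ≤ t → |x t| ≤ R := by
  have h1 := hG.eventually (eventually_gt_atTop (energy G x v 0))
  have h2 : Bornology.IsBounded {y | energy G x v 0 < G y}ᶜ :=
    Bornology.isBounded_compl_iff.2 h1
  obtain ⟨R, hR, h3⟩ := h2.exists_pos_norm_le
  refine ⟨R, hR, fun t ht => ?_⟩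
  refine h3 (x t) ?_
  simp only [mem_compl_iff, mem_ofPred_eq, not_lt]
  exact (potential_le_energy t).trans (h.antitoneOn_energy (mem_Ici.2 le_rfl) ht ht)

lemma exists_potential_lower_bound (h : Trajectory a G x v)
    (hG : Tendsto G (Bornology.cobounded ℝ) atTop) : ∃ m, ∀ t, 0 ≤ t → m ≤ G (x t) := by
  obtain ⟨R, -, hR⟩ := h.exists_position_bound hG
  obtain ⟨m, hm⟩ := (isCompact_Icc (a := -R) (b := R)).bddBelow_image
    h.contDiff.continuous.continuousOn
  exact ⟨m, fun t ht => hm (mem_image_of_mem _ (abs_le.1 (hR t ht)))⟩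

lemma exists_velocity_bound (h : Trajectory a G x v)
    (hG : Tendsto G (Bornology.cobounded ℝ) atTop) : ∃ V > 0, ∀ t, 0 ≤ t → |v t| ≤ V := by
  obtain ⟨m, hm⟩ := h.exists_potential_lower_bound hG
  -- Energy gives `v^2 ≤ 2 (E 0 - m)`, and `|v| ≤ 1 + v^2`.
  refine ⟨1 + 2 * (energy G x v 0 - m), ?_, fun t ht => ?_⟩
  · have := (hm 0 le_rfl).trans (potential_le_energy (v := v) 0)
    linarith
  · have h1 := h.antitoneOn_energy (mem_Ici.2 le_rfl) ht ht
    have h2 := hm t ht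
    rw [energy] at h1
    rw [abs_le]
    constructor <;> nlinarith [sq_nonneg (v t - 1), sq_nonneg (v t + 1)]

lemma exists_tendsto_energy (h : Trajectory a G x v)
    (hG : Tendsto G (Bornology.cobounded ℝ) atTop) :
    ∃ e, Tendsto (energy G x v) atTop (𝓝 e) := by
  obtain ⟨m, hm⟩ := h.exists_potential_lower_bound hG
  have h1 : Antitone fun t => energy G x v (max t 0) := fun s t hst =>
    h.antitoneOn_energy (mem_Ici.2 (le_max_right _ _)) (mem_Ici.2 (le_max_right _ _))
      (max_le_max_right 0 hst)
  refine ⟨_, (tendsto_atTop_ciInf h1 ⟨m, ?_⟩).congr' ?_⟩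
  · rintro _ ⟨t, rfl⟩
    exact (hm _ (le_max_right t 0)).trans (potential_le_energy _)
  · filter_upwards [eventually_ge_atTop 0] with t ht
    rw [max_eq_left ht]

lemma le_energy (h : Trajectory a G x v) {e : ℝ} (he : Tendsto (energy G x v) atTop (𝓝 e))
    {t : ℝ} (ht : 0 ≤ t) : e ≤ energy G x v t := by
  refine le_of_tendsto he ?_
  filter_upwards [eventually_ge_atTop t] with s hs
  exact h.antitoneOn_energy ht (ht.trans hs) hs

lemma exists_lipschitz_bound (h : Trajectory a G x v)
    (hG : Tendsto G (Bornology.cobounded ℝ) atTop)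
    (hL : ∀ s : Set ℝ, Bornology.IsBounded s → ∃ K, LipschitzOnWith K (deriv G) s) :
    ∃ K ≥ 0, ∀ s t, 0 ≤ s → 0 ≤ t →
      |deriv G (x s) - deriv G (x t)| ≤ K * |x s - x t| := by
  obtain ⟨R, -, hR⟩ := h.exists_position_bound hG
  obtain ⟨K, hK⟩ := hL (Icc (-R) R) (Metric.isBounded_Icc _ _)
  refine ⟨K, K.2, fun s t hs ht => ?_⟩
  have := hK.dist_le_mul _ (abs_le.1 (hR s hs)) _ (abs_le.1 (hR t ht))
  simpa [Real.dist_eq] using this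

/-- A trajectory that passes through an equilibrium is constant. -/
lemma constant_of_equilibrium (h : Trajectory a G x v)
    (hG : Tendsto G (Bornology.cobounded ℝ) atTop)
    (hL : ∀ s : Set ℝ, Bornology.IsBounded s → ∃ K, LipschitzOnWith K (deriv G) s)
    {r : ℝ} (hr : 0 ≤ r) (hv : v r = 0) (hg : deriv G (x r) = 0) :
    ∀ t, 0 ≤ t → x t = x r := by
  obtain ⟨K, hK0, hK⟩ := h.exists_lipschitz_bound hG hL
  have ha0 := h.nonneg 0 le_rfl
  -- Grönwall for `q = v^2 + (x - x r)^2`: in `|q'| ≤ L q` the damping contributes `2 a 0`, the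
  -- force `K` and the term `2 (x - x r) v` contributes `1`.
  set L := 2 * a 0 + K + 1 with hLdef
  set q : ℝ → ℝ := fun t => v t ^ 2 + (x t - x r) ^ 2 with hq
  have hqc : ContinuousOn q (Ici 0) :=
    (h.continuousOn_velocity.pow 2).add ((h.continuousOn_position.sub continuousOn_const).pow 2)
  have hqd : ∀ t, 0 < t → HasDerivAt q
      (2 * v t * (-(a t * v t) - deriv G (x t)) + 2 * (x t - x r) * v t) t := by
    intro t ht
    refine (((h.hasDerivAt_momentum ht).pow 2).add
      (((h.hasDerivAt_position ht).sub_const (x r)).pow 2)).congr_deriv ?_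
    push_cast
    ring
  have hbound : ∀ t, 0 < t →
      |2 * v t * (-(a t * v t) - deriv G (x t)) + 2 * (x t - x r) * v t| ≤ L * q t := by
    intro t ht
    have h1 := hK t r ht.le hr
    rw [hg, sub_zero] at h1
    have h2 := h.nonneg t ht.le
    have h3 := h.damping_le ht.le
    have h4 : |v t * deriv G (x t)| ≤ K * (|v t| * |x t - x r|) := by
      rw [abs_mul]
      nlinarith [mul_le_mul_of_nonneg_left h1 (abs_nonneg (v t))]
    have h5 : 2 * (|v t| * |x t - x r|) ≤ q t := by
      simp only [hq]
      nlinarith [sq_nonneg (|v t| - |x t - x r|), sq_abs (v t), sq_abs (x t - x r)]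
    have h6 : |(x t - x r) * v t| = |v t| * |x t - x r| := by rw [abs_mul, mul_comm]
    have h7 : a t * v t ^ 2 ≤ a 0 * q t := by
      simp only [hq]
      nlinarith [sq_nonneg (v t), mul_nonneg ha0 (sq_nonneg (x t - x r)),
        mul_le_mul_of_nonneg_right h3 (sq_nonneg (v t))]
    have h8 : 0 ≤ a t * v t ^ 2 := mul_nonneg h2 (sq_nonneg _)
    have h9 : K * (2 * (|v t| * |x t - x r|)) ≤ K * q t := mul_le_mul_of_nonneg_left h5 hK0
    have h10 := abs_le.1 h4
    have h11 := abs_le.1 h6.le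
    rw [abs_le, hLdef]
    constructor <;> nlinarith
  have hexp : ∀ c : ℝ, ∀ t, 0 < t → HasDerivAt (fun t => q t * Real.exp (c * t))
      ((2 * v t * (-(a t * v t) - deriv G (x t)) + 2 * (x t - x r) * v t + c * q t)
        * Real.exp (c * t)) t := by
    intro c t ht
    refine ((hqd t ht).mul (((hasDerivAt_id t).const_mul c).exp)).congr_deriv ?_
    simp only [id]
    ring
  have hec : ∀ c : ℝ, ContinuousOn (fun t => q t * Real.exp (c * t)) (Ici 0) := fun c =>
    hqc.mul (by fun_prop)
  have hqr : q r = 0 := by simp [hq, hv]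
  -- The weights `exp (L t)` and `exp (-L t)` propagate `q r = 0` backward and forward in time
  -- respectively.
  have key : ∀ t, 0 ≤ t → q t ≤ 0 := by
    intro t ht
    rcases le_total t r with htr | htr
    · have hmono : MonotoneOn (fun t => q t * Real.exp (L * t)) (Ici 0) := by
        refine monotoneOn_of_deriv_nonneg (convex_Ici 0) (hec L) ?_ ?_ <;> intro s hs <;>
          rw [interior_Ici] at hs
        · exact (hexp L s hs).differentiableAt.differentiableWithinAt
        · rw [(hexp L s hs).deriv]
          have := abs_le.1 (hbound s hs)
          exact mul_nonneg (by linarith) (Real.exp_pos _).le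
      have h1 := hmono ht hr htr
      simp only [hqr, zero_mul] at h1
      exact nonpos_of_mul_nonpos_left h1 (Real.exp_pos _)
    · have hanti : AntitoneOn (fun t => q t * Real.exp (-L * t)) (Ici 0) := by
        refine antitoneOn_of_deriv_nonpos (convex_Ici 0) (hec (-L)) ?_ ?_ <;> intro s hs <;>
          rw [interior_Ici] at hs
        · exact (hexp (-L) s hs).differentiableAt.differentiableWithinAt
        · rw [(hexp (-L) s hs).deriv]
          have := abs_le.1 (hbound s hs)
          exact mul_nonpos_of_nonpos_of_nonneg (by linarith) (Real.exp_pos _).le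
      have h1 := hanti hr ht htr
      simp only [hqr, zero_mul] at h1
      exact nonpos_of_mul_nonpos_left h1 (Real.exp_pos _)
  intro t ht
  have h1 := key t ht
  simp only [hq] at h1
  have h2 : (x t - x r) ^ 2 = 0 := by nlinarith [sq_nonneg (v t), sq_nonneg (x t - x r)]
  exact sub_eq_zero.1 (pow_eq_zero_iff (by norm_num) |>.1 h2)

end Trajectory
end DampedGradient

/-! ### Dissipation away from equilibria -/

namespace DampedGradient

/-- A quantity that is bounded below and nonincreasing cannot drop by at least `κ / (t + 2)`
at waiting times of logarithmic length. -/
lemma not_logarithmically_dissipating {E : ℝ → ℝ} (hE : AntitoneOn E (Ici 0)) {m : ℝ}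
    (hm : ∀ t, 0 ≤ t → m ≤ E t) {κ C T : ℝ} (hκ : 0 < κ)
    (hd : ∀ t, T ≤ t → ∃ s, t ≤ s ∧ s ≤ t + C * Real.log (t + 2) ∧
      κ / (s + 2) ≤ E s - E (s + 1)) : False := by
  set D := max C 0 with hD
  have hD0 : 0 ≤ D := le_max_right _ _
  set W := max T 0 with hW
  have hW0 : 0 ≤ W := le_max_right _ _
  have hlog : ∀ t : ℝ, 0 ≤ t → 1 / 2 < Real.log (t + 2) := fun t ht => by
    have := Real.log_le_log (by norm_num : (0:ℝ) < 2) (by linarith : (2:ℝ) ≤ t + 2)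
    linarith [Real.log_two_gt_d9]
  -- During one cycle from `t` to `s + 1`, `log log` grows by at most `(2 + D) / (t + 2)`, while `E`
  -- drops by at least `κ / ((2 + D) (t + 2))`. This `η` balances the two, so `M` does not increase
  -- along the cycles although `log log` diverges.
  set η := κ / (2 + D) ^ 2 with hη
  have hη0 : 0 < η := by positivity
  set M : ℝ → ℝ := fun t => E t + η * Real.log (Real.log (t + 2)) with hM
  have step : ∀ t, W ≤ t → ∃ u, t + 1 ≤ u ∧ M u ≤ M t := by
    intro t hWt
    have ht : 0 ≤ t := hW0.trans hWt
    obtain ⟨s, hts, hst, hs⟩ := hd t ((le_max_left _ _).trans hWt)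
    have hl := hlog t ht
    have hst' : s ≤ t + D * Real.log (t + 2) := by
      have := mul_le_mul_of_nonneg_right (le_max_left C 0) (by linarith : 0 ≤ Real.log (t + 2))
      linarith
    refine ⟨s + 1, by linarith, ?_⟩
    have hlu := hlog (s + 1) (by linarith)
    have h1 : Real.log (t + 2) ≤ t + 1 := by
      have := Real.log_le_sub_one_of_pos (by linarith : 0 < t + 2)
      linarith
    have h2 : s + 2 ≤ (2 + D) * (t + 2) := by nlinarith
    have h3 : κ / ((2 + D) * (t + 2)) ≤ E t - E (s + 1) := by
      have h4 : κ / ((2 + D) * (t + 2)) ≤ κ / (s + 2) :=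
        div_le_div_of_nonneg_left hκ.le (by linarith) h2
      have h5 := hE (mem_Ici.2 ht) (mem_Ici.2 (ht.trans hts)) hts
      linarith
    have hdiff : ∀ p q : ℝ, 0 < p → 0 < q → Real.log q - Real.log p ≤ (q - p) / p := by
      intro p q hp hq
      have := Real.log_le_sub_one_of_pos (div_pos hq hp)
      rw [Real.log_div hq.ne' hp.ne'] at this
      rw [sub_div, div_self hp.ne']
      exact this
    have h6 : Real.log (s + 1 + 2) - Real.log (t + 2) ≤ (2 + D) * Real.log (t + 2) / (t + 2) := by
      refine (hdiff _ _ (by linarith) (by linarith)).trans ?_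
      gcongr
      nlinarith
    have h7 : Real.log (Real.log (s + 1 + 2)) - Real.log (Real.log (t + 2)) ≤
        (2 + D) / (t + 2) := by
      refine (hdiff _ _ (by linarith) (by linarith)).trans ?_
      rw [div_le_iff₀ (by linarith)]
      refine h6.trans (le_of_eq ?_)
      ring
    have h8 : η * ((2 + D) / (t + 2)) = κ / ((2 + D) * (t + 2)) := by
      rw [hη]
      field_simp
    have h9 := mul_le_mul_of_nonneg_left h7 hη0.le
    rw [h8] at h9
    simp only [hM]
    linarith
  have iter : ∀ n : ℕ, ∃ u, W + n ≤ u ∧ M u ≤ M W := by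
    intro n
    induction n with
    | zero => exact ⟨W, by simp, le_rfl⟩
    | succ n ih =>
      obtain ⟨u, hu, hMu⟩ := ih
      obtain ⟨u', hu', hMu'⟩ := step u (by linarith [(n.cast_nonneg : (0:ℝ) ≤ n)])
      exact ⟨u', by push_cast; linarith, hMu'.trans hMu⟩
  have hlim : Tendsto (fun t : ℝ => Real.log (Real.log (t + 2))) atTop atTop :=
    Real.tendsto_log_atTop.comp (Real.tendsto_log_atTop.comp
      (tendsto_atTop_add_const_right _ _ tendsto_id))
  obtain ⟨N, hN⟩ := eventually_atTop.1 (hlim.eventually_gt_atTop ((M W - m) / η))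
  obtain ⟨n, hn⟩ := exists_nat_ge N
  obtain ⟨u, hu, hMu⟩ := iter n
  have h1 := hN u (by linarith)
  rw [div_lt_iff₀ hη0] at h1
  have h2 := hm u (by linarith [(n.cast_nonneg : (0:ℝ) ≤ n)])
  simp only [hM] at hMu h1
  linarith

namespace Trajectory

variable {a G x v : ℝ → ℝ}

lemma exists_position_slope (h : Trajectory a G x v) {s t : ℝ} (hs : 0 ≤ s) (hst : s < t) :
    ∃ r ∈ Ioo s t, x t - x s = v r * (t - s) := by
  obtain ⟨r, hr, hr'⟩ := exists_hasDerivAt_eq_slope x v hst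
    (h.continuousOn_position.mono fun u hu => hs.trans hu.1)
    fun u hu => h.hasDerivAt_position (hs.trans_lt hu.1)
  exact ⟨r, hr, by rw [hr', div_mul_cancel₀ _ (sub_pos.2 hst).ne']⟩

lemma exists_velocity_slope (h : Trajectory a G x v) {s t : ℝ} (hs : 0 ≤ s) (hst : s < t) :
    ∃ r ∈ Ioo s t, v t - v s = (-(a r * v r) - deriv G (x r)) * (t - s) := by
  obtain ⟨r, hr, hr'⟩ := exists_hasDerivAt_eq_slope v _ hst
    (h.continuousOn_velocity.mono fun u hu => hs.trans hu.1)
    fun u hu => h.hasDerivAt_momentum (hs.trans_lt hu.1)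
  exact ⟨r, hr, by rw [hr', div_mul_cancel₀ _ (sub_pos.2 hst).ne']⟩

lemma exists_energy_slope (h : Trajectory a G x v) {s t : ℝ} (hs : 0 ≤ s) (hst : s < t) :
    ∃ r ∈ Ioo s t, energy G x v s - energy G x v t = a r * v r ^ 2 * (t - s) := by
  obtain ⟨r, hr, hr'⟩ := exists_hasDerivAt_eq_slope (energy G x v) _ hst
    (h.continuousOn_energy.mono fun u hu => hs.trans hu.1)
    fun u hu => h.hasDerivAt_energy (hs.trans_lt hu.1)
  refine ⟨r, hr, ?_⟩
  rw [eq_div_iff (sub_pos.2 hst).ne'] at hr'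
  linarith

lemma exists_acceleration_bound (h : Trajectory a G x v)
    (hG : Tendsto G (Bornology.cobounded ℝ) atTop) :
    ∃ B > 0, ∀ t, 0 ≤ t → |-(a t * v t) - deriv G (x t)| ≤ B := by
  obtain ⟨R, -, hR⟩ := h.exists_position_bound hG
  obtain ⟨V, hV, hVb⟩ := h.exists_velocity_bound hG
  obtain ⟨g, hg⟩ := (isCompact_Icc (a := -R) (b := R)).exists_bound_of_continuousOn
    h.continuous_deriv.continuousOn
  have ha0 := h.nonneg 0 le_rfl
  have hg0 := (norm_nonneg _).trans (hg _ (abs_le.1 (hR 0 le_rfl)))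
  refine ⟨a 0 * V + g + 1, by positivity, fun t ht => ?_⟩
  have h1 : |a t * v t| ≤ a 0 * V := by
    rw [abs_mul, abs_of_nonneg (h.nonneg t ht)]
    exact mul_le_mul (h.damping_le ht) (hVb t ht) (abs_nonneg _) ha0
  have h2 : |deriv G (x t)| ≤ g := hg _ (abs_le.1 (hR t ht))
  have h3 := abs_le.1 h1
  have h4 := abs_le.1 h2
  rw [abs_le]
  constructor <;> linarith

/-- Bounded acceleration keeps the speed above `ν / 2` for a fixed time `τ`. Taking `τ ≤ 1 / 2`
leaves another half unit in which to wait for a fast moment. -/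
lemma exists_dissipation_of_fast (h : Trajectory a G x v)
    (hG : Tendsto G (Bornology.cobounded ℝ) atTop) {ν : ℝ} (hν : 0 < ν) :
    ∃ κ > 0, ∀ s, 0 ≤ s → ν ≤ |v s| →
      κ * a (s + 1 / 2) ≤ energy G x v s - energy G x v (s + 1 / 2) := by
  obtain ⟨B, hB, hBb⟩ := h.exists_acceleration_bound hG
  set τ := min (1 / 2) (ν / (2 * B)) with hτ
  have hτ0 : 0 < τ := by positivity
  have hτB : B * τ ≤ ν / 2 := by
    have h1 := mul_le_mul_of_nonneg_left (min_le_right (1 / 2) (ν / (2 * B))) hB.le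
    have h2 : B * (ν / (2 * B)) = ν / 2 := by field_simp
    linarith
  have hτh : τ ≤ 1 / 2 := min_le_left _ _
  refine ⟨ν ^ 2 / 4 * τ, by positivity, fun s hs hvs => ?_⟩
  obtain ⟨r, hr, hre⟩ := h.exists_energy_slope hs (by linarith : s < s + τ)
  obtain ⟨q, hq, hqe⟩ := h.exists_velocity_slope hs hr.1
  have h1 := hBb q (hs.trans hq.1.le)
  have h2 : |v r - v s| ≤ ν / 2 := by
    rw [hqe, abs_mul, abs_of_pos (sub_pos.2 hr.1)]
    refine le_trans (mul_le_mul h1 ?_ (sub_pos.2 hr.1).le hB.le) hτB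
    linarith [hr.2]
  have h3 : ν / 2 ≤ |v r| := by
    have := abs_sub_abs_le_abs_sub (v s) (v r)
    rw [abs_sub_comm] at this
    linarith
  have h4 : ν ^ 2 / 4 ≤ v r ^ 2 := by
    rw [← sq_abs (v r)]
    nlinarith
  have hr0 : 0 ≤ r := hs.trans hr.1.le
  have h5 : a (s + 1 / 2) ≤ a r :=
    h.anti hr0 (mem_Ici.2 (by linarith)) (by linarith [hr.2])
  have h6 := h.nonneg (s + 1 / 2) (by linarith)
  have h7 := h.antitoneOn_energy (mem_Ici.2 (by linarith : 0 ≤ s + τ))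
    (mem_Ici.2 (by linarith : 0 ≤ s + 1 / 2)) (by linarith)
  have h8 : a (s + 1 / 2) * (ν ^ 2 / 4) ≤ a r * v r ^ 2 :=
    mul_le_mul h5 h4 (by positivity) (h6.trans h5)
  have h9 := mul_le_mul_of_nonneg_right h8 hτ0.le
  have h10 : s + τ - s = τ := by ring
  rw [h10] at hre
  linarith

/-- Away from equilibria a definite multiple of the damping is dissipated in unit time. -/
lemma exists_dissipation (h : Trajectory a G x v)
    (hG : Tendsto G (Bornology.cobounded ℝ) atTop)
    (hL : ∀ s : Set ℝ, Bornology.IsBounded s → ∃ K, LipschitzOnWith K (deriv G) s)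
    (hlow : ∃ c > 0, ∀ t, 0 ≤ t → c / (t + 1) ≤ a t) {μ : ℝ} (hμ : 0 < μ) :
    ∃ κ > 0, ∀ t, 0 ≤ t → μ ≤ v t ^ 2 + deriv G (x t) ^ 2 →
      κ / (t + 2) ≤ energy G x v t - energy G x v (t + 1) := by
  obtain ⟨c, hc, hca⟩ := hlow
  obtain ⟨K, hK0, hK⟩ := h.exists_lipschitz_bound hG hL
  have ha0 := h.nonneg 0 le_rfl
  -- If `|v| < ν` on a half unit of time, the acceleration is at most `4 ν` somewhere, so the force
  -- there is at most `(4 + a 0) ν`. Moving back to `t` adds `K ν / 2`. Then `v^2 + G'^2 ≤ (1 + M^2)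
  -- ν^2 = μ / 2`, which is too small.
  set M := 4 + a 0 + K / 2 with hM
  set ν := √(μ / (2 * (1 + M ^ 2))) with hνdef
  have hν : 0 < ν := Real.sqrt_pos.2 (by positivity)
  have hνsq : ν ^ 2 * (1 + M ^ 2) = μ / 2 := by
    rw [hνdef, Real.sq_sqrt (by positivity)]
    field_simp
  obtain ⟨κ, hκ, hκd⟩ := h.exists_dissipation_of_fast hG hν
  refine ⟨κ * c, by positivity, fun t ht hμt => ?_⟩
  have hfast : ∃ s ∈ Icc t (t + 1 / 2), ν ≤ |v s| := by
    by_contra! hslow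
    obtain ⟨r, hr, hre⟩ := h.exists_velocity_slope ht (by linarith : t < t + 1 / 2)
    obtain ⟨q, hq, hqe⟩ := h.exists_position_slope ht hr.1
    have hr0 : 0 ≤ r := ht.trans hr.1.le
    have h1 := abs_lt.1 (hslow t ⟨le_rfl, by linarith⟩)
    have h2 := abs_lt.1 (hslow (t + 1 / 2) ⟨by linarith, le_rfl⟩)
    have h3 := hslow r ⟨hr.1.le, hr.2.le⟩
    have h4 := hslow q ⟨hq.1.le, (hq.2.trans hr.2).le⟩
    have h5 : |x t - x r| ≤ ν / 2 := by
      rw [abs_sub_comm, hqe, abs_mul, abs_of_pos (sub_pos.2 hr.1)]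
      have := mul_le_mul h4.le (by linarith [hr.2] : r - t ≤ 1 / 2) (sub_pos.2 hr.1).le hν.le
      linarith
    have h6 : |a r * v r| ≤ a 0 * ν := by
      rw [abs_mul, abs_of_nonneg (h.nonneg r hr0)]
      exact mul_le_mul (h.damping_le hr0) h3.le (abs_nonneg _) ha0
    have h7 := hK t r ht hr0
    have h8 := mul_le_mul_of_nonneg_left h5 hK0
    have h9 : |deriv G (x t)| ≤ M * ν := by
      have h10 := abs_le.1 h6
      have h11 := abs_le.1 h7
      rw [abs_le, hM]
      constructor <;> linarith
    have h12 : deriv G (x t) ^ 2 ≤ (M * ν) ^ 2 := sq_le_sq' (abs_le.1 h9).1 (abs_le.1 h9).2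
    have h13 : v t ^ 2 ≤ ν ^ 2 := sq_le_sq' h1.1.le h1.2.le
    nlinarith
  obtain ⟨s, hs, hvs⟩ := hfast
  have hs0 : 0 ≤ s := ht.trans hs.1
  have h1 := hκd s hs0 hvs
  have h2 := h.antitoneOn_energy ht hs0 hs.1
  have h3 := h.antitoneOn_energy (mem_Ici.2 (by linarith : 0 ≤ s + 1 / 2))
    (mem_Ici.2 (by linarith : 0 ≤ t + 1)) (by linarith [hs.2])
  have h4 := h.anti (mem_Ici.2 (by linarith : 0 ≤ s + 1 / 2))
    (mem_Ici.2 (by linarith : 0 ≤ t + 1)) (by linarith [hs.2])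
  have h5 := hca (t + 1) (by linarith)
  have h6 : κ * (c / (t + 1 + 1)) ≤ κ * a (s + 1 / 2) :=
    mul_le_mul_of_nonneg_left (h5.trans h4) hκ.le
  have h7 : κ * (c / (t + 1 + 1)) = κ * c / (t + 2) := by
    rw [mul_div_assoc, add_assoc]
    norm_num
  linarith

/-- Dissipation is uniform while the position stays in a closed set without equilibria on the
limiting energy level. -/
lemma exists_dissipation_on (h : Trajectory a G x v)
    (hG : Tendsto G (Bornology.cobounded ℝ) atTop)
    (hL : ∀ s : Set ℝ, Bornology.IsBounded s → ∃ K, LipschitzOnWith K (deriv G) s)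
    (hlow : ∃ c > 0, ∀ t, 0 ≤ t → c / (t + 1) ≤ a t) {e : ℝ}
    (he : Tendsto (energy G x v) atTop (𝓝 e)) {S : Set ℝ} (hS : IsClosed S)
    (hSe : ∀ q ∈ S, deriv G q = 0 → G q ≠ e) :
    ∃ κ > 0, ∃ T ≥ 0, ∀ t, T ≤ t → x t ∈ S →
      κ / (t + 2) ≤ energy G x v t - energy G x v (t + 1) := by
  have key : ∃ μ > 0, ∃ T, ∀ t, T ≤ t → x t ∈ S → μ ≤ v t ^ 2 + deriv G (x t) ^ 2 := by
    -- Compactness: otherwise `v` and `G'(x)` tend to `0` along times tending to infinity, and a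
    -- limit point of the positions is a critical point in `S` at level `e`.
    by_contra! hcon
    have h1 : ∀ n : ℕ, ∃ t, (n : ℝ) ≤ t ∧ x t ∈ S ∧
        v t ^ 2 + deriv G (x t) ^ 2 < 1 / ((n : ℝ) + 1) := fun n =>
      hcon _ (by positivity) n
    choose u hu huS hus using h1
    have hu0 : ∀ n, 0 ≤ u n := fun n => (Nat.cast_nonneg n).trans (hu n)
    obtain ⟨R, -, hR⟩ := h.exists_position_bound hG
    obtain ⟨q, -, φ, hφ, hq⟩ := (isCompact_Icc (a := -R) (b := R)).tendsto_subseq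
      fun n => abs_le.1 (hR (u n) (hu0 n))
    have hutop : Tendsto (fun n => u (φ n)) atTop atTop :=
      (tendsto_atTop_mono hu tendsto_natCast_atTop_atTop).comp hφ.tendsto_atTop
    have hsum : Tendsto (fun n => v (u (φ n)) ^ 2 + deriv G (x (u (φ n))) ^ 2) atTop (𝓝 0) :=
      (squeeze_zero (fun n => by positivity) (fun n => (hus n).le)
        tendsto_one_div_add_atTop_nhds_zero_nat).comp hφ.tendsto_atTop
    have hv2 : Tendsto (fun n => v (u (φ n)) ^ 2) atTop (𝓝 0) :=
      squeeze_zero (fun n => sq_nonneg _) (fun n => by nlinarith [sq_nonneg (deriv G (x (u (φ n))))])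
        hsum
    have hg2 : Tendsto (fun n => deriv G (x (u (φ n))) ^ 2) atTop (𝓝 0) :=
      squeeze_zero (fun n => sq_nonneg _) (fun n => by nlinarith [sq_nonneg (v (u (φ n)))]) hsum
    have hgq : deriv G q ^ 2 = 0 :=
      tendsto_nhds_unique (((h.continuous_deriv.tendsto q).comp hq).pow 2) hg2
    have hGq : 0 / 2 + G q = e :=
      tendsto_nhds_unique ((hv2.div_const 2).add ((h.contDiff.continuous.tendsto q).comp hq))
        (he.comp hutop)
    have hqS : q ∈ S := hS.mem_of_tendsto hq (Eventually.of_forall fun n => huS _)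
    exact hSe q hqS (pow_eq_zero_iff (by norm_num) |>.1 hgq) (by linarith)
  obtain ⟨μ, hμ, T, hT⟩ := key
  obtain ⟨κ, hκ, hκd⟩ := h.exists_dissipation hG hL hlow hμ
  exact ⟨κ, hκ, max T 0, le_max_right _ _, fun t ht hxt =>
    hκd t ((le_max_right _ _).trans ht) (hT t ((le_max_left _ _).trans ht) hxt)⟩

/-- Staying in `S` would cost `κ / (t + 2)` in every unit of time, with no waiting at all (`C = 0`).
-/
lemma frequently_notMem (h : Trajectory a G x v)
    (hG : Tendsto G (Bornology.cobounded ℝ) atTop)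
    (hL : ∀ s : Set ℝ, Bornology.IsBounded s → ∃ K, LipschitzOnWith K (deriv G) s)
    (hlow : ∃ c > 0, ∀ t, 0 ≤ t → c / (t + 1) ≤ a t) {e : ℝ}
    (he : Tendsto (energy G x v) atTop (𝓝 e)) {S : Set ℝ} (hS : IsClosed S)
    (hSe : ∀ q ∈ S, deriv G q = 0 → G q ≠ e) : ∃ᶠ t in atTop, x t ∉ S := by
  intro hev
  simp only [not_not] at hev
  obtain ⟨κ, hκ, T, hT0, hT⟩ := h.exists_dissipation_on hG hL hlow he hS hSe
  obtain ⟨N, hN⟩ := eventually_atTop.1 hev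
  refine not_logarithmically_dissipating h.antitoneOn_energy (fun t ht => h.le_energy he ht)
    (C := 0) (T := max T N) hκ fun t ht => ⟨t, le_rfl, by simp, ?_⟩
  exact hT t ((le_max_left _ _).trans ht) (hN t ((le_max_right _ _).trans ht))

lemma exists_equilibrium (h : Trajectory a G x v)
    (hG : Tendsto G (Bornology.cobounded ℝ) atTop)
    (hL : ∀ s : Set ℝ, Bornology.IsBounded s → ∃ K, LipschitzOnWith K (deriv G) s)
    (hlow : ∃ c > 0, ∀ t, 0 ≤ t → c / (t + 1) ≤ a t) {e : ℝ}
    (he : Tendsto (energy G x v) atTop (𝓝 e)) : ∃ p, deriv G p = 0 ∧ G p = e := by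
  by_contra! hcon
  obtain ⟨t, ht⟩ := (h.frequently_notMem hG hL hlow he isClosed_univ
    fun q _ => hcon q).exists
  exact ht (mem_univ _)

end Trajectory
end DampedGradient

/-! ### Convergence to the critical point on the limiting level -/

namespace DampedGradient

/-- The convexity inequality based at `p` gives the growth; adding the one based at `y` gives the
monotonicity of `G'`. -/
lemma StronglyConvexNear.exists_growth {G : ℝ → ℝ} {p : ℝ} (h : StronglyConvexNear G p)
    (hp : deriv G p = 0) : ∃ ε > 0, ∃ δ > 0, ∀ y, |y - p| < ε →
      G p + δ * (y - p) ^ 2 ≤ G y ∧ 2 * δ * (y - p) ^ 2 ≤ (y - p) * deriv G y := by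
  obtain ⟨ε, hε, δ, hδ, H⟩ := h
  refine ⟨ε, hε, δ, hδ, fun y hy => ?_⟩
  have hy' : y ∈ Ioo (p - ε) (p + ε) := by
    have := abs_lt.1 hy
    exact ⟨by linarith, by linarith⟩
  have hp' : p ∈ Ioo (p - ε) (p + ε) := ⟨by linarith, by linarith⟩
  have h1 := H p hp' y hy'
  have h2 := H y hy' p hp'
  rw [hp] at h1
  constructor <;> nlinarith

lemma StronglyConcaveNear.exists_decay {G : ℝ → ℝ} {p : ℝ} (h : StronglyConcaveNear G p)
    (hp : deriv G p = 0) : ∃ ε > 0, ∃ δ > 0, ∀ y, |y - p| < ε → G y ≤ G p - δ * (y - p) ^ 2 := by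
  obtain ⟨ε, hε, δ, hδ, H⟩ := StronglyConvexNear.exists_growth h (by simp [deriv.fun_neg, hp])
  exact ⟨ε, hε, δ, hδ, fun y hy => by linarith [(H y hy).1]⟩

lemma abs_arsinh_le_log {z Z : ℝ} (hz : |z| ≤ Z) : |Real.arsinh z| ≤ Real.log (1 + 2 * Z) := by
  have hZ : 0 ≤ Z := (abs_nonneg z).trans hz
  have h1 : Real.arsinh Z ≤ Real.log (1 + 2 * Z) := by
    have h2 : √(1 + Z ^ 2) ≤ 1 + Z := by
      rw [Real.sqrt_le_left (by linarith)]
      nlinarith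
    rw [Real.arsinh]
    exact Real.log_le_log (by positivity) (by linarith)
  have h3 := abs_le.1 hz
  have h4 := Real.arsinh_le_arsinh.2 h3.1
  have h5 := Real.arsinh_le_arsinh.2 h3.2
  rw [Real.arsinh_neg] at h4
  rw [abs_le]
  constructor <;> linarith

/-- A waiting time that is logarithmic in terms of its end is logarithmic in terms of its
beginning. -/
lemma exists_log_bound {δ κ Y : ℝ} (hδ : 0 < δ) (hκ : 0 < κ) (hY0 : 0 ≤ Y) :
    ∃ C > 0, ∀ t r, 2 * C ≤ t → t < r →
      √(2 * δ) * (r - t) ≤ 2 * Real.log (1 + 2 * (Y * √(δ / (κ / (r + 2))))) →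
      r ≤ t + 2 * C * Real.log (t + 2) := by
  set A := 1 + δ / κ with hA
  have hA0 : 0 < A := by positivity
  have hYA : 0 ≤ Y * A := by positivity
  set lA := Real.log (1 + 2 * (Y * A)) with hlA
  have hlA0 : 0 ≤ lA := Real.log_nonneg (by linarith)
  have hsδ : 0 < √(2 * δ) := Real.sqrt_pos.2 (by positivity)
  -- The square root is at most `A (r + 2)`, so the logarithm is at most `lA + log (r + 2) ≤ (2 lA +
  -- 1) log (r + 2)`, using `log (r + 2) > 1 / 2`.
  refine ⟨2 / √(2 * δ) * (2 * lA + 1), by positivity, ?_⟩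
  have hCe : √(2 * δ) * (2 / √(2 * δ) * (2 * lA + 1)) = 2 * (2 * lA + 1) := by field_simp
  have hC0 : 0 < 2 / √(2 * δ) * (2 * lA + 1) := by positivity
  generalize 2 / √(2 * δ) * (2 * lA + 1) = C at hCe hC0 ⊢
  intro t r htC htr htime
  have ht0 : 0 ≤ t := by linarith
  have hr0 : 0 ≤ r := ht0.trans htr.le
  have hsq : √(δ / (κ / (r + 2))) ≤ A * (r + 2) := by
    have h1 : δ / (κ / (r + 2)) = δ / κ * (r + 2) := by field_simp
    rw [h1, Real.sqrt_le_left (by positivity), hA]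
    have h2 : 0 < δ / κ := by positivity
    have h3 : δ / κ ≤ (1 + δ / κ) ^ 2 := by nlinarith
    rw [mul_pow]
    exact mul_le_mul h3 (by nlinarith) (by linarith) (by positivity)
  have hlr : 1 / 2 < Real.log (r + 2) := by
    have := Real.log_le_log (by norm_num : (0:ℝ) < 2) (by linarith : (2:ℝ) ≤ r + 2)
    linarith [Real.log_two_gt_d9]
  have h4 : Real.log (1 + 2 * (Y * √(δ / (κ / (r + 2))))) ≤ lA + Real.log (r + 2) := by
    rw [hlA, ← Real.log_mul (by linarith) (by linarith)]
    refine Real.log_le_log (by positivity) ?_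
    have h1 := mul_le_mul_of_nonneg_left hsq hY0
    have h2 : (1 + 2 * (Y * A)) * (r + 2) = 2 * (Y * (A * (r + 2))) + (r + 2) := by ring
    rw [h2]
    linarith
  have h5 : r - t ≤ C * Real.log (r + 2) := by
    have h6 : lA ≤ 2 * lA * Real.log (r + 2) := by nlinarith
    refine le_of_mul_le_mul_left ?_ hsδ
    rw [← mul_assoc, hCe]
    linarith
  have h8 : Real.log (r + 2) - Real.log (t + 2) ≤ (r - t) / (t + 2) := by
    have := Real.log_le_sub_one_of_pos (by positivity : 0 < (r + 2) / (t + 2))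
    rw [Real.log_div (by linarith) (by linarith)] at this
    refine this.trans (le_of_eq ?_)
    field_simp
    ring
  -- The condition `2 C ≤ t` lets half of `r - t` be absorbed on the left, whence the factor `2 C`
  -- in the conclusion.
  have h9 : C * ((r - t) / (t + 2)) ≤ (r - t) / 2 := by
    rw [← mul_div_assoc, div_le_div_iff₀ (by linarith) (by norm_num)]
    nlinarith
  have h10 := mul_le_mul_of_nonneg_left h8 hC0.le
  linarith

namespace Trajectory

variable {a G x v : ℝ → ℝ}

lemma frequently_near (h : Trajectory a G x v)
    (hG : Tendsto G (Bornology.cobounded ℝ) atTop)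
    (hL : ∀ s : Set ℝ, Bornology.IsBounded s → ∃ K, LipschitzOnWith K (deriv G) s)
    (hlow : ∃ c > 0, ∀ t, 0 ≤ t → c / (t + 1) ≤ a t) {p : ℝ}
    (he : Tendsto (energy G x v) atTop (𝓝 (G p)))
    (hp : ∀ q, deriv G q = 0 → G q = G p → q = p) {ε : ℝ} (hε : 0 < ε) :
    ∃ᶠ t in atTop, |x t - p| < ε := by
  have hS : IsClosed {y : ℝ | ε ≤ |y - p|} := isClosed_le continuous_const (by fun_prop)
  refine (h.frequently_notMem hG hL hlow he hS ?_).mono fun t ht => not_le.1 ht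
  intro q hq hq0 hqe
  have : ε ≤ |q - p| := hq
  rw [hp q hq0 hqe, sub_self, abs_zero] at this
  linarith

/-- Potential well: once the energy is below `G p + δ ε^2`, the motion cannot cross `|x - p| = ε`,
and it does come inside at some later time. -/
lemma tendsto_of_stronglyConvexNear (h : Trajectory a G x v)
    (hG : Tendsto G (Bornology.cobounded ℝ) atTop)
    (hL : ∀ s : Set ℝ, Bornology.IsBounded s → ∃ K, LipschitzOnWith K (deriv G) s)
    (hlow : ∃ c > 0, ∀ t, 0 ≤ t → c / (t + 1) ≤ a t) {p : ℝ}
    (he : Tendsto (energy G x v) atTop (𝓝 (G p)))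
    (hp : ∀ q, deriv G q = 0 → G q = G p → q = p) (hp0 : deriv G p = 0)
    (hconv : StronglyConvexNear G p) : Tendsto x atTop (𝓝 p) := by
  obtain ⟨ε₀, hε₀, δ, hδ, H⟩ := hconv.exists_growth hp0
  rw [Metric.tendsto_atTop']
  intro ε₁ hε₁
  obtain ⟨ε, hε, hεlt⟩ := exists_between (lt_min hε₀ hε₁)
  have hε0 : ε < ε₀ := hεlt.trans_le (min_le_left _ _)
  have hlt : G p < G p + δ * ε ^ 2 := by
    have : 0 < δ * ε ^ 2 := by positivity
    linarith
  obtain ⟨N, hN⟩ := eventually_atTop.1 (he.eventually_lt_const hlt)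
  obtain ⟨T, hT, hxT⟩ := frequently_atTop.1 (h.frequently_near hG hL hlow he hp hε) (max N 0)
  have hT0 : 0 ≤ T := (le_max_right _ _).trans hT
  have hTN : N ≤ T := (le_max_left _ _).trans hT
  refine ⟨T, fun t ht => ?_⟩
  rw [Real.dist_eq]
  refine lt_trans ?_ (hεlt.trans_le (min_le_right _ _))
  by_contra! hcon
  have hcont : ContinuousOn (fun s => |x s - p|) (Icc T t) :=
    ((h.continuousOn_position.mono fun s hs => hT0.trans hs.1).sub continuousOn_const).abs
  obtain ⟨s, hs, hsε⟩ := intermediate_value_Icc ht.le hcont ⟨hxT.le, hcon⟩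
  simp only at hsε
  have h1 := (H (x s) (by rw [hsε]; exact hε0)).1
  have h2 := hN s (hTN.trans hs.1)
  have h3 := potential_le_energy (G := G) (x := x) (v := v) s
  rw [← sq_abs (x s - p), hsε] at h1
  linarith

/-- The time spent on a passage near a maximum is at most logarithmic in the inverse of the
energy excess. -/
lemma transit_time_le (h : Trajectory a G x v) {p δ σ Y s r : ℝ} (hδ : 0 < δ) (hσ : 0 < σ)
    (hs : 0 ≤ s) (hsr : s < r) (hY : ∀ t, 0 ≤ t → |x t - p| ≤ Y)
    (hpot : ∀ t ∈ Ioo s r, G (x t) ≤ G p - δ * (x t - p) ^ 2)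
    (hen : ∀ t ∈ Ioo s r, G p + σ ≤ energy G x v t) :
    √(2 * δ) * (r - s) ≤ 2 * Real.log (1 + 2 * (Y * √(δ / σ))) := by
  set b := √(δ / σ) with hb
  have hb0 : 0 < b := Real.sqrt_pos.2 (by positivity)
  have hb2 : b ^ 2 = δ / σ := Real.sq_sqrt (by positivity)
  have hbound : ∀ t, 0 ≤ t → |Real.arsinh ((x t - p) * b)| ≤ Real.log (1 + 2 * (Y * b)) := by
    intro t ht
    refine abs_arsinh_le_log ?_
    rw [abs_mul, abs_of_pos hb0]
    exact mul_le_mul_of_nonneg_right (hY t ht) hb0.le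
  -- The energy excess gives `v^2 ≥ 2 (σ + δ (x - p)^2)`, which says exactly that `arsinh ((x - p)
  -- b)` moves at speed at least `√(2 δ)`; its range is only logarithmic in `b`.
  obtain ⟨q, hq, hqe⟩ := exists_hasDerivAt_eq_slope (fun t => Real.arsinh ((x t - p) * b)) _ hsr
    (Real.continuous_arsinh.comp_continuousOn
      (((h.continuousOn_position.mono fun u hu => hs.trans hu.1).sub continuousOn_const).mul
        continuousOn_const))
    fun u hu => (((h.hasDerivAt_position (hs.trans_lt hu.1)).sub_const p).mul_const b).arsinh
  rw [eq_div_iff (sub_pos.2 hsr).ne', smul_eq_mul] at hqe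
  have hw : 0 < 1 + ((x q - p) * b) ^ 2 := by positivity
  have hspeed : √(2 * δ) ≤ |(√(1 + ((x q - p) * b) ^ 2))⁻¹ * (v q * b)| := by
    refine Real.sqrt_le_left (abs_nonneg _) |>.2 ?_
    rw [sq_abs, mul_pow, inv_pow, Real.sq_sqrt hw.le, ← div_eq_inv_mul, le_div_iff₀ hw, mul_pow,
      mul_pow, hb2]
    have h1 := hpot q hq
    have h2 := hen q hq
    rw [energy] at h2
    have h3 : 2 * (σ + δ * (x q - p) ^ 2) ≤ v q ^ 2 := by linarith
    have h4 : 2 * δ * (1 + (x q - p) ^ 2 * (δ / σ)) = 2 * (σ + δ * (x q - p) ^ 2) * (δ / σ) := by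
      field_simp
    rw [h4]
    exact mul_le_mul_of_nonneg_right h3 (by positivity)
  have h5 := mul_le_mul_of_nonneg_right hspeed (sub_pos.2 hsr).le
  rw [← abs_of_pos (sub_pos.2 hsr), ← abs_mul, abs_of_pos (sub_pos.2 hsr), hqe] at h5
  have h6 := abs_sub (Real.arsinh ((x r - p) * b)) (Real.arsinh ((x s - p) * b))
  have h7 := hbound r (hs.trans hsr.le)
  have h8 := hbound s hs
  linarith

/-- If the motion left the `ε`-neighbourhood at arbitrarily late times, the first exit after any
late `t` would come after a logarithmic wait and cost a multiple of the inverse time. -/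
lemma tendsto_of_stronglyConcaveNear (h : Trajectory a G x v)
    (hG : Tendsto G (Bornology.cobounded ℝ) atTop)
    (hL : ∀ s : Set ℝ, Bornology.IsBounded s → ∃ K, LipschitzOnWith K (deriv G) s)
    (hlow : ∃ c > 0, ∀ t, 0 ≤ t → c / (t + 1) ≤ a t) {p : ℝ}
    (he : Tendsto (energy G x v) atTop (𝓝 (G p)))
    (hp : ∀ q, deriv G q = 0 → G q = G p → q = p) (hp0 : deriv G p = 0)
    (hconc : StronglyConcaveNear G p) : Tendsto x atTop (𝓝 p) := by
  obtain ⟨ε₀, hε₀, δ, hδ, H⟩ := hconc.exists_decay hp0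
  rw [Metric.tendsto_nhds]
  intro ε₁ hε₁
  obtain ⟨ε, hε, hεlt⟩ := exists_between (lt_min hε₀ hε₁)
  have hε0 : ε < ε₀ := hεlt.trans_le (min_le_left _ _)
  suffices hsuff : ∀ᶠ t in atTop, |x t - p| < ε by
    filter_upwards [hsuff] with t ht
    rw [Real.dist_eq]
    exact ht.trans (hεlt.trans_le (min_le_right _ _))
  by_contra hcon
  have hout : ∃ᶠ t in atTop, ε ≤ |x t - p| := by
    simpa only [not_lt] using not_eventually.1 hcon
  have hS : IsClosed {y : ℝ | ε ≤ |y - p|} := isClosed_le continuous_const (by fun_prop)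
  obtain ⟨κ, hκ, T, hT0, hT⟩ := h.exists_dissipation_on hG hL hlow he hS fun q hq hq0 hqe => by
    have : ε ≤ |q - p| := hq
    rw [hp q hq0 hqe, sub_self, abs_zero] at this
    linarith
  obtain ⟨R, hR0, hR⟩ := h.exists_position_bound hG
  set Y := R + |p| with hYdef
  have hY0 : 0 ≤ Y := by positivity
  have hY : ∀ t, 0 ≤ t → |x t - p| ≤ Y := fun t ht =>
    (abs_sub _ _).trans (by linarith [hR t ht])
  obtain ⟨C, hC0, hC⟩ := exists_log_bound hδ hκ hY0
  refine not_logarithmically_dissipating h.antitoneOn_energy (fun t ht => h.le_energy he ht)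
    (C := 2 * C) (T := max T (2 * C)) hκ fun t ht => ?_
  have htT : T ≤ t := (le_max_left _ _).trans ht
  have htC : 2 * C ≤ t := (le_max_right _ _).trans ht
  have ht0 : 0 ≤ t := hT0.trans htT
  obtain ⟨u, hu, hxu⟩ := frequently_atTop.1 hout t
  have hcont : ContinuousOn (fun s => |x s - p|) (Icc t u) :=
    ((h.continuousOn_position.mono fun s hs => ht0.trans hs.1).sub continuousOn_const).abs
  have hcomp : IsCompact (Icc t u ∩ (fun s => |x s - p|) ⁻¹' Ici ε) :=
    isCompact_Icc.of_isClosed_subset (hcont.preimage_isClosed_of_isClosed isClosed_Icc isClosed_Ici)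
      inter_subset_left
  obtain ⟨r, ⟨hrI, hxr⟩, hleast⟩ := hcomp.exists_isLeast ⟨u, ⟨hu, le_rfl⟩, hxu⟩
  have hinside : ∀ s ∈ Ico t r, |x s - p| < ε := by
    intro s hs
    by_contra! hc
    exact absurd (hleast ⟨⟨hs.1, hs.2.le.trans hrI.2⟩, hc⟩) (not_le.2 hs.2)
  have hdiss := hT r (htT.trans hrI.1) hxr
  refine ⟨r, hrI.1, ?_, hdiss⟩
  rcases hrI.1.eq_or_lt with htr | htr
  · rw [← htr]
    have := Real.log_nonneg (by linarith : 1 ≤ t + 2)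
    have : 0 ≤ 2 * C * Real.log (t + 2) := by positivity
    linarith
  have hr0 : 0 ≤ r := ht0.trans htr.le
  -- The loss still to come on `[r, r + 1]` is a lower bound for the energy excess during the whole
  -- passage before `r`.
  have hσ : 0 < κ / (r + 2) := by positivity
  have htime := h.transit_time_le (p := p) hδ hσ ht0 htr hY
    (fun s hs => H _ ((hinside s ⟨hs.1.le, hs.2⟩).trans hε0))
    (fun s hs => by
      have h1 := h.antitoneOn_energy (mem_Ici.2 (ht0.trans hs.1.le)) (mem_Ici.2 hr0) hs.2.le
      have h2 := h.le_energy he (by linarith : 0 ≤ r + 1)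
      linarith)
  exact hC t r htC htr htime

end Trajectory
end DampedGradient

/-! ### Sign changes of the velocity -/

namespace DampedGradient

lemma IsSolution.trajectory {a G x : ℝ → ℝ} (h : IsSolution a G x)
    (ha_nonneg : ∀ t, 0 ≤ t → 0 ≤ a t) (ha_anti : AntitoneOn a (Ici 0))
    (hG : ContDiff ℝ 1 G) : Trajectory a G x (velocity x) where
  nonneg := ha_nonneg
  anti := ha_anti
  contDiff := hG
  position t ht := (h.contDiffOn.differentiableOn (by norm_num) t ht).hasDerivWithinAt
  momentum t ht := by
    have h1 : ContDiffOn ℝ 1 (velocity x) (Ici 0) :=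
      h.contDiffOn.derivWithin (uniqueDiffOn_Ici 0) (by norm_num)
    refine (h1.differentiableOn (by norm_num) t ht).hasDerivWithinAt.congr_deriv ?_
    linarith [h.equation t ht]

lemma mem_signChanges_of_hasDerivAt {v : ℝ → ℝ} {v' t : ℝ} (ht : 0 < t) (hvt : v t = 0)
    (hv : HasDerivAt v v' t) (hv' : v' ≠ 0) : t ∈ signChanges v := by
  have h1 : ∀ᶠ y in 𝓝[≠] t, 0 < slope v t y * v' :=
    (hv.tendsto_slope.mul_const v').eventually_const_lt (mul_self_pos.2 hv')
  rw [eventually_nhdsWithin_iff, Metric.eventually_nhds_iff] at h1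
  obtain ⟨ε, hε, H⟩ := h1
  have hs : ∀ y, |y - t| < ε → y ≠ t → ∃ k, v y = k * (y - t) ∧ 0 < k * v' := fun y hy hyt => by
    refine ⟨slope v t y, ?_, H (by rwa [Real.dist_eq]) hyt⟩
    rw [slope_def_field, hvt, sub_zero, div_mul_cancel₀ _ (sub_ne_zero.2 hyt)]
  refine ⟨ht, min ε t, lt_min hε ht, min_le_right _ _, fun r hr s hs' => ?_⟩
  have hεm := min_le_left ε t
  obtain ⟨k, hk, hkv⟩ := hs r (by rw [abs_lt]; constructor <;> linarith [hr.1, hr.2]) hr.2.ne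
  obtain ⟨l, hl, hlv⟩ := hs s (by rw [abs_lt]; constructor <;> linarith [hs'.1, hs'.2]) hs'.1.ne'
  have h2 : 0 < (k * l) * v' ^ 2 := by nlinarith [mul_pos hkv hlv]
  have h3 : 0 < k * l := pos_of_mul_pos_left h2 (sq_nonneg _)
  have h4 : 0 < (t - r) * (s - t) := mul_pos (sub_pos.2 hr.2) (sub_pos.2 hs'.1)
  rw [hk, hl]
  nlinarith [mul_pos h3 h4]

lemma eq_zero_of_mem_signChanges {v : ℝ → ℝ} {t : ℝ} (ht : t ∈ signChanges v)
    (hv : ContinuousAt v t) : v t = 0 := by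
  obtain ⟨-, ε, hε, -, H⟩ := ht
  have h1 : Tendsto (fun η : ℝ => v (t - η) * v (t + η)) (𝓝[>] 0) (𝓝 (v t * v t)) := by
    refine Tendsto.mono_left ?_ nhdsWithin_le_nhds
    have h2 : Tendsto (fun η : ℝ => t - η) (𝓝 0) (𝓝 t) := by
      have : Continuous fun η : ℝ => t - η := by fun_prop
      simpa using this.tendsto 0
    have h3 : Tendsto (fun η : ℝ => t + η) (𝓝 0) (𝓝 t) := by
      have : Continuous fun η : ℝ => t + η := by fun_prop
      simpa using this.tendsto 0
    exact (hv.tendsto.comp h2).mul (hv.tendsto.comp h3)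
  have h4 : v t * v t ≤ 0 := by
    refine le_of_tendsto h1 ?_
    filter_upwards [Ioo_mem_nhdsGT hε] with η hη
    exact (H _ ⟨by linarith [hη.2], by linarith [hη.1]⟩ _
      ⟨by linarith [hη.1], by linarith [hη.2]⟩).le
  nlinarith [mul_self_nonneg (v t)]

namespace Trajectory

variable {a G x v : ℝ → ℝ}

/-- At an accumulation point of zeros both `v` and its derivative, there equal to `-G'(x)`, would
vanish. -/
lemma finite_zeros (h : Trajectory a G x v)
    (hne : ∀ t, 0 ≤ t → v t = 0 → deriv G (x t) ≠ 0) (T : ℝ) :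
    {t | t ∈ Icc 0 T ∧ v t = 0}.Finite := by
  by_contra hinf
  obtain ⟨r, hr, hacc⟩ := Set.Infinite.exists_accPt_of_subset_isCompact hinf isCompact_Icc
    fun t ht => ht.1
  rw [accPt_iff_frequently_nhdsNE] at hacc
  have hr0 : (0:ℝ) ≤ r := hr.1
  have key : ∀ᶠ z in 𝓝[Ici 0 \ {r}] r, v z ≠ 0 := by
    by_cases hv : v r = 0
    · refine (h.momentum r hr0).eventually_ne ?_
      rw [hv, mul_zero, neg_zero, zero_sub, neg_ne_zero]
      exact hne r hr0 hv
    · exact ((h.continuousOn_velocity r hr0).mono sdiff_subset).eventually_ne hv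
  rw [eventually_nhdsWithin_iff] at key
  obtain ⟨z, ⟨hz, hzv⟩, hzr, hzk⟩ := (hacc.and_eventually
    (eventually_mem_nhdsWithin.and (key.filter_mono nhdsWithin_le_nhds))).exists
  exact hzk ⟨hz.1, hzr⟩ hzv

/-- Near a minimum the motion oscillates. -/
lemma frequently_eq_of_stronglyConvexNear (h : Trajectory a G x v)
    (ha : Tendsto a atTop (𝓝 0)) {p : ℝ} (hx : Tendsto x atTop (𝓝 p)) (hp0 : deriv G p = 0)
    (hconv : StronglyConvexNear G p) : ∃ᶠ t in atTop, x t = p := by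
  obtain ⟨ε, hε, δ, hδ, H⟩ := hconv.exists_growth hp0
  intro hev
  have hnear : ∀ᶠ t in atTop, |x t - p| < ε := by
    simpa [Real.dist_eq] using (Metric.tendsto_nhds.1 hx) ε hε
  have hasmall : ∀ᶠ t in atTop, a t ^ 2 < 2 * δ :=
    (ha.pow 2).eventually_lt_const (by simpa using hδ)
  obtain ⟨T, hT⟩ := eventually_atTop.1
    (hev.and (hnear.and (hasmall.and (eventually_gt_atTop 0))))
  set c := min δ (1 / 2) with hc
  have hc0 : 0 < c := by positivity
  -- Riccati substitution, legitimate while `x ≠ p`. With `a^2 < 2 δ` and `G'(x) / (x - p) ≥ 2 δ`,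
  -- completing the square gives `w' ≤ -δ - w^2 / 2`. So `arctan w` decreases at rate at least `c`
  -- and would drop by `π` in time `π / c`, more than its range allows.
  set w : ℝ → ℝ := fun t => v t / (x t - p) with hw
  have hwd : ∀ t, T ≤ t → HasDerivAt w
      (-(a t * w t) - deriv G (x t) / (x t - p) - w t ^ 2) t := by
    intro t ht
    obtain ⟨hne, -, -, ht0⟩ := hT t ht
    have hne' : x t - p ≠ 0 := sub_ne_zero.2 hne
    refine ((h.hasDerivAt_momentum ht0).div ((h.hasDerivAt_position ht0).sub_const p)
      hne').congr_deriv ?_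
    simp only [hw]
    field_simp
  have hwle : ∀ t, T ≤ t →
      -(a t * w t) - deriv G (x t) / (x t - p) - w t ^ 2 ≤ -c * (1 + w t ^ 2) := by
    intro t ht
    obtain ⟨hne, hxe, hat, -⟩ := hT t ht
    have hne' : x t - p ≠ 0 := sub_ne_zero.2 hne
    have h1 : 2 * δ ≤ deriv G (x t) / (x t - p) := by
      have h2 : deriv G (x t) / (x t - p) = (x t - p) * deriv G (x t) / (x t - p) ^ 2 := by
        field_simp
      rw [h2, le_div_iff₀ (by positivity)]
      exact (H _ hxe).2
    have h3 : c ≤ δ := min_le_left _ _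
    have h4 : c * w t ^ 2 ≤ 1 / 2 * w t ^ 2 :=
      mul_le_mul_of_nonneg_right (min_le_right _ _) (sq_nonneg _)
    nlinarith [sq_nonneg (a t + w t)]
  have hlt : T < T + Real.pi / c := by
    have := Real.pi_pos
    have : 0 < Real.pi / c := by positivity
    linarith
  obtain ⟨r, hr, hre⟩ := exists_hasDerivAt_eq_slope (fun t => Real.arctan (w t)) _ hlt
    (fun t ht => (hwd t ht.1).arctan.continuousAt.continuousWithinAt)
    fun t ht => (hwd t ht.1.le).arctan
  rw [eq_div_iff (sub_pos.2 hlt).ne', add_sub_cancel_left] at hre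
  have h1 : 1 / (1 + w r ^ 2) *
      (-(a r * w r) - deriv G (x r) / (x r - p) - w r ^ 2) ≤ -c := by
    rw [one_div, ← div_eq_inv_mul, div_le_iff₀ (by positivity)]
    exact hwle r hr.1.le
  have hL : 0 < Real.pi / c := by linarith
  have h2 := mul_le_mul_of_nonneg_right h1 hL.le
  have h3 : -c * (Real.pi / c) = -Real.pi := by field_simp
  have h4 := Real.neg_pi_div_two_lt_arctan (w (T + Real.pi / c))
  have h5 := Real.arctan_lt_pi_div_two (w T)
  linarith

/-- Between two visits to `p`, Rolle gives a zero of `v`; it is simple, hence a sign change. -/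
lemma infinite_signChanges (h : Trajectory a G x v)
    (hne : ∀ t, 0 ≤ t → v t = 0 → deriv G (x t) ≠ 0)
    (ha : Tendsto a atTop (𝓝 0)) {p : ℝ} (hx : Tendsto x atTop (𝓝 p)) (hp0 : deriv G p = 0)
    (hconv : StronglyConvexNear G p) : (signChanges v).Infinite := by
  intro hfin
  obtain ⟨M, hM⟩ := hfin.bddAbove
  have hfreq := frequently_atTop.1 (h.frequently_eq_of_stronglyConvexNear ha hx hp0 hconv)
  obtain ⟨s, hs, hxs⟩ := hfreq (max M 0)
  obtain ⟨t, ht, hxt⟩ := hfreq (s + 1)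
  have hs0 : 0 ≤ s := (le_max_right _ _).trans hs
  have hst : s < t := by linarith
  obtain ⟨r, hr, hre⟩ := h.exists_position_slope hs0 hst
  rw [hxs, hxt, sub_self, zero_eq_mul] at hre
  have hvr : v r = 0 := hre.resolve_right (sub_pos.2 hst).ne'
  have hr0 : 0 < r := hs0.trans_lt hr.1
  have hmem : r ∈ signChanges v := by
    refine mem_signChanges_of_hasDerivAt hr0 hvr (h.hasDerivAt_momentum hr0) ?_
    rw [hvr, mul_zero, neg_zero, zero_sub, neg_ne_zero]
    exact hne r hr0.le hvr
  linarith [hM hmem, hr.1, le_max_left M 0]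

/-- If `v = 0` close to `p`, the energy is `G(x) ≥ G p`, and strict maximality forces `x = p`, an
excluded equilibrium. So all sign changes lie in a compact interval. -/
lemma finite_signChanges (h : Trajectory a G x v)
    (hne : ∀ t, 0 ≤ t → v t = 0 → deriv G (x t) ≠ 0) {p : ℝ}
    (he : Tendsto (energy G x v) atTop (𝓝 (G p))) (hx : Tendsto x atTop (𝓝 p))
    (hp0 : deriv G p = 0) (hconc : StronglyConcaveNear G p) : (signChanges v).Finite := by
  obtain ⟨ε, hε, δ, hδ, H⟩ := hconc.exists_decay hp0
  have hnear : ∀ᶠ t in atTop, |x t - p| < ε := by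
    simpa [Real.dist_eq] using (Metric.tendsto_nhds.1 hx) ε hε
  obtain ⟨T, hT⟩ := eventually_atTop.1 hnear
  refine (h.finite_zeros hne T).subset fun t ht => ?_
  have ht0 : 0 < t := ht.1
  have hvt := eq_zero_of_mem_signChanges ht (h.hasDerivAt_momentum ht0).continuousAt
  refine ⟨⟨ht0.le, ?_⟩, hvt⟩
  by_contra! hlt
  have h1 := h.le_energy he ht0.le
  have h2 := H _ (hT t hlt.le)
  rw [energy, hvt] at h1
  have h3 : x t - p = 0 := by
    by_contra hxp
    have : 0 < δ * (x t - p) ^ 2 := by positivity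
    linarith
  exact hne t ht0.le hvt (by rw [sub_eq_zero.1 h3, hp0])

end Trajectory

/-! ### Nature of the critical point -/

lemma StronglyConvexNear.isLocalMin {G : ℝ → ℝ} {p : ℝ} (h : StronglyConvexNear G p)
    (hp : deriv G p = 0) : IsLocalMin G p := by
  obtain ⟨ε, hε, δ, hδ, H⟩ := h.exists_growth hp
  filter_upwards [Metric.ball_mem_nhds p hε] with y hy
  have := (H y (by simpa [Real.dist_eq] using hy)).1
  nlinarith [sq_nonneg (y - p)]

lemma StronglyConvexNear.not_isLocalMax {G : ℝ → ℝ} {p : ℝ} (h : StronglyConvexNear G p)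
    (hp : deriv G p = 0) : ¬ IsLocalMax G p := by
  obtain ⟨ε, hε, δ, hδ, H⟩ := h.exists_growth hp
  intro hmax
  have h1 : ∀ᶠ y in 𝓝 p, G y ≤ G p ∧ y ∈ Metric.ball p ε :=
    hmax.and (Metric.ball_mem_nhds p hε)
  obtain ⟨y, ⟨hy, hyb⟩, hne⟩ :=
    ((h1.filter_mono nhdsWithin_le_nhds).and (self_mem_nhdsWithin : {p}ᶜ ∈ 𝓝[≠] p)).exists
  have h2 := (H y (by simpa [Real.dist_eq] using hyb)).1
  have h3 : y - p ≠ 0 := sub_ne_zero.2 hne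
  have : 0 < δ * (y - p) ^ 2 := by positivity
  linarith

lemma StronglyConcaveNear.isLocalMax {G : ℝ → ℝ} {p : ℝ} (h : StronglyConcaveNear G p)
    (hp : deriv G p = 0) : IsLocalMax G p := by
  simpa using (StronglyConvexNear.isLocalMin h (by simp [deriv.fun_neg, hp])).neg

lemma StronglyConcaveNear.not_isLocalMin {G : ℝ → ℝ} {p : ℝ} (h : StronglyConcaveNear G p)
    (hp : deriv G p = 0) : ¬ IsLocalMin G p := fun hmin =>
  StronglyConvexNear.not_isLocalMax h (by simp [deriv.fun_neg, hp]) hmin.neg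

end DampedGradient

theorem mainTheorem1
    (a : ℝ → ℝ)
    (ha_diff : DifferentiableOn ℝ a (Ici 0))
    (ha_nonneg : ∀ t, 0 ≤ t → 0 ≤ a t)
    (ha_anti : AntitoneOn a (Ici 0))
    (ha_lim : Tendsto a atTop (𝓝 0))
    (ha_lower : ∃ c > 0, ∀ t, 0 ≤ t → c / (t + 1) ≤ a t)
    (G : ℝ → ℝ)
    (hG_C1 : ContDiff ℝ 1 G)
    (hG_lip : ∀ s : Set ℝ, Bornology.IsBounded s → ∃ K, LipschitzOnWith K (deriv G) s)
    (hG_coercive : Tendsto G (Bornology.cobounded ℝ) atTop)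
    (hG_finite : {p : ℝ | deriv G p = 0}.Finite)
    (hG_distinct : InjOn G {p : ℝ | deriv G p = 0})
    (hG_strong : ∀ p, deriv G p = 0 →
      DampedGradient.StronglyConvexNear G p ∨ DampedGradient.StronglyConcaveNear G p)
    (x : ℝ → ℝ)
    (hx : DampedGradient.IsSolution a G x) :
    ∃ l : ℝ, Tendsto x atTop (𝓝 l) ∧
      ((¬ ∃ p : ℝ, ∀ t, 0 ≤ t → x t = p) →
        (IsLocalMax G l ↔ (DampedGradient.signChanges (DampedGradient.velocity x)).Finite) ∧
        (IsLocalMin G l ↔ (DampedGradient.signChanges (DampedGradient.velocity x)).Infinite)) := by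

  have h := hx.trajectory ha_nonneg ha_anti hG_C1
  obtain ⟨e, he⟩ := h.exists_tendsto_energy hG_coercive
  obtain ⟨p, hp0, rfl⟩ := h.exists_equilibrium hG_coercive hG_lip ha_lower he
  have hp : ∀ q, deriv G q = 0 → G q = G p → q = p := fun q hq hqp => hG_distinct hq hp0 hqp
  have hne : (¬ ∃ p : ℝ, ∀ t, 0 ≤ t → x t = p) →
      ∀ t, 0 ≤ t → DampedGradient.velocity x t = 0 → deriv G (x t) ≠ 0 :=
    fun hnc t ht hvt hg => hnc ⟨x t, h.constant_of_equilibrium hG_coercive hG_lip ht hvt hg⟩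
  rcases hG_strong p hp0 with hconv | hconc
  · have hlim := h.tendsto_of_stronglyConvexNear hG_coercive hG_lip ha_lower he hp hp0 hconv
    refine ⟨p, hlim, fun hnc => ?_⟩
    have hinf := h.infinite_signChanges (hne hnc) ha_lim hlim hp0 hconv
    exact ⟨iff_of_false (hconv.not_isLocalMax hp0) hinf, iff_of_true (hconv.isLocalMin hp0) hinf⟩
  · have hlim := h.tendsto_of_stronglyConcaveNear hG_coercive hG_lip ha_lower he hp hp0 hconc
    refine ⟨p, hlim, fun hnc => ?_⟩
    have hfin := h.finite_signChanges (hne hnc) he hlim hp0 hconc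
    exact ⟨iff_of_true (hconc.isLocalMax hp0) hfin,
      iff_of_false (hconc.not_isLocalMin hp0) (not_not.2 hfin)⟩
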